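/- Let $a>0$, let $b=(b(j))_{j\ge 1}$ be a sequence of non-negative reals, not identically zero, and let $\xi=(\xi(k))_{k\in\mathbb Z}$ be independent, identically distributed, non-negative random variables with $\lambda_1:=\mathbb E[\xi(0)]\in(0,\infty)$ and $\sigma^2:=\mathrm{Var}[\xi(0)]\in(0,\infty)$. Let $X=(X(k))_{k\in\mathbb Z}$ be a weakly stationary (square-integrable, with constant mean and with $\mathrm{Cov}[X(n),X(n+k)]$ independent of $n$), non-anticipative solution of the ARCH($\infty$) equations $$X(k)=\varsigma(k)\xi(k),\qquad \varsigma(k)=a+\sum_{j=1}^\infty b(j)X(k-j),\qquad k\in\mathbb Z,$$ where non-anticipative means that for each $k$ the shock $\xi(k)$ is independent of the past $(X(m))_{m<k}$. Write $\rho(k)=\mathrm{Cov}[X(0),X(k)]$ for its autocovariance function. Assume (S$_1$) $\lambda_1\sum_{j=1}^\infty b(j)<1$; (S$_2$) $\frac{\sigma}{\lambda_1}\bigl(\sum_{j=1}^\infty z(j)^2\bigr)^{1/2}<1$, where $z$ is the sequence with $\frac{1}{1-\lambda_1\sum_{j=1}^\infty b(j)x^j}=\sum_{j=0}^\infty z(j)x^j$.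 For $r\in(0,1]$ let $\mathcal W(r)$ be the set of sequences $\gamma:\{0,1,2,\dots\}\to(0,\infty)$ with $\lim_{n\to\infty}\gamma(n-1)/\gamma(n)=1/r$, $\sum_{i=0}^\infty\gamma(i)r^{-i}<\infty$ and $$\lim_{m\to\infty}\Bigl(\limsup_{n\to\infty}\frac1{\gamma(n)}\sum_{i=m}^{n-m}\gamma(n-i)\gamma(i)\Bigr)=0,$$ and let $\mathcal W^{\downarrow}(r)$ be the set of $\gamma\in\mathcal W(r)$ for which there is a non-increasing sequence $\delta:\{0,1,2,\dots\}\to(0,\infty)$ with $\gamma(n)/\delta(n)\to1$. Let $r\in(0,1]$ and $\gamma\in\mathcal W^{\downarrow}(r)$. Then the following are equivalent: (a) $\lambda_1\sum_{j=1}^\infty b(j)r^{-j}<1$ and $\limsup_{n\to\infty} b(n)/\gamma(n)\in(0,\infty)$; (b) $\limsup_{n\to\infty}\rho(n)/\gamma(n)\in(0,\infty)$. -/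

import Mathlib

open MeasureTheory ProbabilityTheory Filter Topology

noncomputable section

namespace ArchInf

/-- The class of positive real sequences `W(r)`. The inner upper limit is taken in the extended
reals, so that it is meaningful also for unbounded sequences. -/
structure InW (r : ℝ) (γ : ℕ → ℝ) : Prop where
  pos : ∀ n, 0 < γ n
  ratio : Tendsto (fun n : ℕ => γ n / γ (n + 1)) atTop (𝓝 (1 / r))
  summable : Summable fun i : ℕ => γ i * r⁻¹ ^ i
  conv : Tendsto
    (fun m : ℕ => limsup
      (fun n : ℕ => (((1 / γ n) * ∑ i ∈ Finset.Icc m (n - m), γ (n - i) * γ i : ℝ) : EReal))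
      atTop)
    atTop (𝓝 0)

/-- The subclass `W↓(r)` of those sequences in `W(r)` which are asymptotic to a positive
non-increasing sequence. -/
def InWDown (r : ℝ) (g : ℕ → ℝ) : Prop :=
  InW r g ∧ ∃ γ : ℕ → ℝ, (∀ n, 0 < γ n) ∧ (∀ n, γ (n + 1) ≤ γ n) ∧
    Tendsto (fun n => g n / γ n) atTop (𝓝 1)

variable {Ω : Type*} [MeasurableSpace Ω]

/-- `ξ` is a sequence of independent, identically distributed, non-negative random variables. -/
structure IsShocks (P : Measure Ω) (ξ : ℤ → Ω → ℝ) : Prop where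
  measurable : ∀ k, Measurable (ξ k)
  indep : iIndepFun ξ P
  identDistrib : ∀ k, IdentDistrib (ξ k) (ξ 0) P P
  nonneg : ∀ k, ∀ᵐ ω ∂P, 0 ≤ ξ k ω

/-- `X` is a (non-anticipative) solution of the ARCH(∞) equations
`X(k) = ς(k) ξ(k)`, `ς(k) = a + ∑_{j ≥ 1} b(j) X(k - j)`: the shock at time `k` is independent of
the past `(X(m))_{m < k}`. The kernel `b` is used at the indices `j ≥ 1` only;
the sum over `j ≥ 1` is written as a sum over `j : ℕ` with `j + 1` in place of `j`. -/
structure IsSolution (P : Measure Ω) (a : ℝ) (b : ℕ → ℝ) (ξ X : ℤ → Ω → ℝ) : Prop where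
  measurable : ∀ k, Measurable (X k)
  summable : ∀ k : ℤ, ∀ᵐ ω ∂P, Summable fun j : ℕ => b (j + 1) * X (k - ((j : ℤ) + 1)) ω
  eqn : ∀ k : ℤ, ∀ᵐ ω ∂P,
    X k ω = (a + ∑' j : ℕ, b (j + 1) * X (k - ((j : ℤ) + 1)) ω) * ξ k ω
  nonanticipative : ∀ k : ℤ, IndepFun (ξ k) (fun ω (m : Set.Iio k) => X (m : ℤ) ω) P

/-- Weak stationarity. -/
structure IsWeaklyStationary (P : Measure Ω) (X : ℤ → Ω → ℝ) : Prop where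
  memLp : ∀ k, MemLp (X k) 2 P
  mean : ∀ k, P[X k] = P[X 0]
  cov : ∃ ρ : ℤ → ℝ, ∀ n k, cov[X n, X (n + k); P] = ρ k

/-- The autocovariance function `ρ(k) = Cov[X(0), X(k)]`. -/
def autocov (P : Measure Ω) (X : ℤ → Ω → ℝ) (k : ℤ) : ℝ := cov[X 0, X k; P]

/-- The sequence `z` defined by `1 / (1 - l ∑_{j ≥ 1} b(j) x ^ j) = ∑_{j ≥ 0} z(j) x ^ j`, the
quotient being the inverse in the ring of power series. -/
def zCoeff (l : ℝ) (b : ℕ → ℝ) (n : ℕ) : ℝ :=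
  PowerSeries.coeff n (1 - PowerSeries.mk fun j => if j = 0 then 0 else l * b j)⁻¹

/-- `l ∑_{j ≥ 1} b(j) < 1`. -/
def CondS1 (l : ℝ) (b : ℕ → ℝ) : Prop :=
  (Summable fun j : ℕ => b (j + 1)) ∧ l * ∑' j : ℕ, b (j + 1) < 1

/-- `(s / l) (∑_{j ≥ 1} z(j) ^ 2) ^ (1 / 2) < 1`. -/
def CondS2 (l s : ℝ) (b : ℕ → ℝ) : Prop :=
  (Summable fun j : ℕ => zCoeff l b (j + 1) ^ 2) ∧
    s / l * √(∑' j : ℕ, zCoeff l b (j + 1) ^ 2) < 1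

end ArchInf

end

namespace ArchInf

/-! Put `l = λ₁ b`. The centred variables satisfy `y = l * y + ν` with noise `ν(k) = (ξ(k) - λ₁)
ς(k)`, and non-anticipation makes the `ν(k)` pairwise orthogonal in `L²`. Under (S₁) the resolvent
`z` is summable, so `y = z * ν` and `ρ(n) = ∑ s(i) z(i) z(n+i)` with `s(i) = ‖ν(-i)‖²`
(`exists_hasSum_autocov`). All terms are non-negative, so the term `i = 0` gives `z ≤ ρ / s(0)`;
conversely, near-monotonicity of `γ` turns `z ≤ c γ` into `ρ ≤ const · c γ` (`correlation_le`).
Hence `ρ` and `z` are `O(γ)`, or `o(γ)`, together. Between `b` and `z`: `l ≤ z` is immediate. After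
weighting by `r⁻ⁿ` the sequence `γ` is subexponential, and if the generating function of `l` at
`r⁻¹` is below one, the renewal equation passes `O(γ)` and `o(γ)` from `l` to `z` (`resolvent_le`,
`resolvent_isLittleO`). That generating function is indeed below one once `z = O(γ)`. An upper limit
in `(0, ∞)` means `O(γ)` but not `o(γ)`. -/

/-- `z = δ₀ + l * z`, i.e. `z` is the resolvent of the convolution kernel `l`. -/
def IsResolvent (l z : ℕ → ℝ) : Prop :=
  ∀ n, z n = (if n = 0 then 1 else 0) + ∑ p ∈ Finset.HasAntidiagonal.antidiagonal n, l p.1 * z p.2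

/-! ### Resolvents of non-negative kernels. -/

namespace IsResolvent

variable {l z : ℕ → ℝ}

lemma eq_sum_range (h : IsResolvent l z) (n : ℕ) :
    z n = (if n = 0 then 1 else 0) + ∑ j ∈ Finset.range (n + 1), l j * z (n - j) := by
  rw [h n, Finset.Nat.sum_antidiagonal_eq_sum_range_succ_mk]

lemma apply_zero (h : IsResolvent l z) (hl0 : l 0 = 0) : z 0 = 1 := by
  rw [h 0]; simp [hl0]

lemma nonneg (h : IsResolvent l z) (hl0 : l 0 = 0) (hl : ∀ n, 0 ≤ l n) (n : ℕ) : 0 ≤ z n := by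
  induction n using Nat.strong_induction_on with
  | _ n ih =>
    rw [h.eq_sum_range n]
    refine add_nonneg (by split_ifs <;> norm_num) (Finset.sum_nonneg fun j hj => ?_)
    rcases Nat.eq_zero_or_pos j with rfl | hj0
    · simp [hl0]
    · have := Finset.mem_range.1 hj
      exact mul_nonneg (hl j) (ih _ (by omega))

lemma kernel_le (h : IsResolvent l z) (hl0 : l 0 = 0) (hl : ∀ n, 0 ≤ l n) (n : ℕ) :
    l n ≤ z n := by
  rw [h.eq_sum_range n]
  have h1 : l n * z (n - n) ≤ ∑ j ∈ Finset.range (n + 1), l j * z (n - j) :=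
    Finset.single_le_sum (f := fun j => l j * z (n - j))
      (fun j _ => mul_nonneg (hl j) (h.nonneg hl0 hl _)) (by simp)
  rw [Nat.sub_self, h.apply_zero hl0, mul_one] at h1
  have : (0 : ℝ) ≤ if n = 0 then 1 else 0 := by split_ifs <;> norm_num
  linarith

/-- Geometric weights commute with convolution; `q = r⁻¹` reduces `W(r)` to the case `r = 1`. -/
lemma scale (h : IsResolvent l z) (q : ℝ) :
    IsResolvent (fun n => l n * q ^ n) (fun n => z n * q ^ n) := by
  intro n
  simp only
  rw [h n, add_mul, Finset.sum_mul]
  congr 1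
  · split_ifs with hn <;> simp [hn]
  · refine Finset.sum_congr rfl fun p hp => ?_
    rw [← Finset.HasAntidiagonal.mem_antidiagonal.1 hp, pow_add]; ring

lemma summable (h : IsResolvent l z) (hl0 : l 0 = 0) (hl : ∀ n, 0 ≤ l n)
    (hs : Summable l) (h1 : ∑' n, l n < 1) : Summable z := by
  have hz := h.nonneg hl0 hl
  have hA : 0 < 1 - ∑' n, l n := by linarith
  refine summable_of_sum_range_le (c := 1 / (1 - ∑' n, l n)) hz fun N => ?_
  -- The pairs with `i + j < N` lie in the square `i, j < N`, so the partial sums obey `Z ≤ 1 + A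
  -- Z`.
  have key : ∑ n ∈ Finset.range N, z n ≤ 1 + (∑' n, l n) * ∑ n ∈ Finset.range N, z n := by
    calc ∑ n ∈ Finset.range N, z n
        = ∑ n ∈ Finset.range N, (if n = 0 then 1 else 0)
          + ∑ n ∈ Finset.range N, ∑ p ∈ Finset.HasAntidiagonal.antidiagonal n, l p.1 * z p.2 := by
          rw [← Finset.sum_add_distrib]
          exact Finset.sum_congr rfl fun n _ => h n
      _ ≤ 1 + (∑ n ∈ Finset.range N, l n) * ∑ n ∈ Finset.range N, z n := by
          refine add_le_add ?_ ?_
          · rw [Finset.sum_ite_eq']; split_ifs <;> norm_num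
          · rw [Finset.sum_mul_sum, ← Finset.sum_product', Finset.sum_sigma']
            have hinj : Set.InjOn (fun x : (_ : ℕ) × ℕ × ℕ => x.2)
                ((Finset.range N).sigma Finset.HasAntidiagonal.antidiagonal) := by
              rintro ⟨n, p⟩ hp ⟨n', p'⟩ hp' heq
              simp only [Finset.coe_sigma, Set.mem_sigma_iff, Finset.mem_coe, Finset.mem_range,
                Finset.HasAntidiagonal.mem_antidiagonal] at hp hp' heq
              subst heq
              obtain rfl : n = n' := by omega
              rfl
            rw [← Finset.sum_image (f := fun p : ℕ × ℕ => l p.1 * z p.2) hinj]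
            refine Finset.sum_le_sum_of_subset_of_nonneg (fun p hp => ?_)
              fun _ _ _ => mul_nonneg (hl _) (hz _)
            obtain ⟨⟨n, q⟩, hq, rfl⟩ := Finset.mem_image.1 hp
            simp only [Finset.mem_sigma, Finset.mem_range,
              Finset.HasAntidiagonal.mem_antidiagonal] at hq
            simp only [Finset.mem_product, Finset.mem_range]
            omega
      _ ≤ _ := by
          gcongr
          · exact Finset.sum_nonneg fun n _ => hz n
          · exact hs.sum_le_tsum _ fun n _ => hl n
  rw [le_div_iff₀ hA]; linarith

/-- The generating function of a non-negative kernel is less than one wherever the generating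
function of the resolvent converges. -/
lemma tsum_kernel_lt_one (h : IsResolvent l z) (hl0 : l 0 = 0) (hl : ∀ n, 0 ≤ l n)
    (hs : Summable z) : Summable l ∧ ∑' n, l n < 1 := by
  have hz := h.nonneg hl0 hl
  have hls : Summable l := .of_nonneg_of_le hl (h.kernel_le hl0 hl) hs
  refine ⟨hls, ?_⟩
  have hprod := tsum_mul_tsum_eq_tsum_sum_antidiagonal_of_summable_norm hls.norm hs.norm
  have hsum : Summable fun n => ∑ p ∈ Finset.HasAntidiagonal.antidiagonal n, l p.1 * z p.2 :=
    (summable_norm_sum_mul_antidiagonal_of_summable_norm hls.norm hs.norm).of_norm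
  have hz1 : ∑' n, z n = 1 + (∑' n, l n) * ∑' n, z n := by
    rw [hprod]
    conv_lhs => rw [funext h]
    rw [Summable.tsum_add (summable_of_hasFiniteSupport
      ((Set.finite_singleton 0).subset fun n hn => by simpa using hn)) hsum, tsum_ite_eq]
  -- `Z = 1 + A Z` with `Z ≥ 0` rules out `A ≥ 1`.
  have hpos : 0 ≤ ∑' n, z n := tsum_nonneg hz
  nlinarith

end IsResolvent

/-! ### Renewal equation against subexponential sequences. -/

/-- The class `W(1)` without the summability condition. -/
structure IsSubexp (Γ : ℕ → ℝ) : Prop where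
  pos : ∀ n, 0 < Γ n
  ratio : Tendsto (fun n : ℕ => Γ n / Γ (n + 1)) atTop (𝓝 1)
  conv : ∀ ε > 0, ∃ m, 1 ≤ m ∧
    ∀ᶠ n in atTop, ∑ i ∈ Finset.Icc m (n - m), Γ (n - i) * Γ i ≤ ε * Γ n

lemma IsSubexp.shift_le {Γ : ℕ → ℝ} (h : IsSubexp Γ) {ε : ℝ} (hε : 0 < ε) (m : ℕ) :
    ∀ᶠ n in atTop, ∀ j < m, Γ (n - j) ≤ (1 + ε) * Γ n := by
  have hlim : ∀ j, Tendsto (fun n => Γ n / Γ (n + j)) atTop (𝓝 1) := by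
    intro j
    induction j with
    | zero => exact tendsto_const_nhds.congr fun n => (div_self (h.pos n).ne').symm
    | succ j ih =>
      have := ih.mul (h.ratio.comp (tendsto_add_atTop_nat j))
      rw [mul_one] at this
      refine this.congr fun n => ?_
      have := (h.pos (n + j)).ne'
      simp only [Function.comp]
      rw [← add_assoc]
      field_simp
  have hev : ∀ j, ∀ᶠ n in atTop, Γ (n - j) ≤ (1 + ε) * Γ n := by
    intro j
    have h1 : ∀ᶠ n in atTop, Γ n / Γ (n + j) < 1 + ε :=
      (hlim j).eventually_lt_const (by linarith)
    filter_upwards [(tendsto_sub_atTop_nat j).eventually h1, eventually_ge_atTop j] with n hn hj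
    rw [Nat.sub_add_cancel hj, div_lt_iff₀ (h.pos n)] at hn
    exact hn.le
  have := (Finset.range m).eventually_all.2 fun j _ => hev j
  simpa using this

/-- One step of the renewal equation, with the convolution split at distance `m` from the ends. -/
lemma IsSubexp.resolvent_step {Γ l z : ℕ → ℝ} (hΓ : IsSubexp Γ) (h : IsResolvent l z)
    (hl0 : l 0 = 0) (hl : ∀ n, 0 ≤ l n) (hs : Summable l) {C : ℝ} (hC : 0 ≤ C)
    (hlC : ∀ n, l n ≤ C * Γ n) {ε : ℝ} (hε : 0 < ε) :
    ∃ m N : ℕ, ∀ n ≥ N, m ≤ n ∧ ∀ M c D : ℝ, 0 ≤ M → 0 ≤ c → 0 ≤ D →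
      (∀ k < n, z k ≤ M * Γ k) → (∀ k, n < k + m → k < n → z k ≤ c * Γ k) →
      (∀ k, n < k + m → k ≤ n → l k ≤ D * Γ k) →
      z n ≤ ((1 + ε) * (∑' j, l j) * c + C * ε * M
        + D * (1 + ε) * ∑ i ∈ Finset.range m, z i) * Γ n := by
  have hz := h.nonneg hl0 hl
  obtain ⟨m, hm1, hm⟩ := hΓ.conv ε hε
  obtain ⟨N, hN⟩ := eventually_atTop.1
    ((hm.and (hΓ.shift_le hε m)).and (eventually_ge_atTop (2 * m + 1)))
  refine ⟨m, N, fun n hn => ?_⟩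
  obtain ⟨⟨hconv, hshift⟩, hnm⟩ := hN n hn
  refine ⟨by omega, fun M c D hM hc hD hzM hzc hlD => ?_⟩
  have hΓn := hΓ.pos n
  -- Small lags: `z` is evaluated near `n`, where `c` applies. The lag `j = 0`, which would involve
  -- `z n` itself, vanishes by `hl0`.
  have hfirst : ∑ j ∈ Finset.Ico 0 m, l j * z (n - j) ≤ (1 + ε) * (∑' j, l j) * c * Γ n := by
    calc ∑ j ∈ Finset.Ico 0 m, l j * z (n - j)
        ≤ ∑ j ∈ Finset.Ico 0 m, l j * (c * ((1 + ε) * Γ n)) := by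
          refine Finset.sum_le_sum fun j hj => ?_
          have hj := (Finset.mem_Ico.1 hj).2
          rcases Nat.eq_zero_or_pos j with rfl | hj0
          · simp [hl0]
          · refine mul_le_mul_of_nonneg_left ((hzc _ (by omega) (by omega)).trans ?_) (hl j)
            exact mul_le_mul_of_nonneg_left (hshift j hj) hc
      _ = (∑ j ∈ Finset.Ico 0 m, l j) * (c * ((1 + ε) * Γ n)) := by rw [Finset.sum_mul]
      _ ≤ (∑' j, l j) * (c * ((1 + ε) * Γ n)) := by
          gcongr
          exact hs.sum_le_tsum _ fun n _ => hl n
      _ = _ := by ring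
  -- Both indices are at least `m`: the truncated convolution of `Γ` contributes only `ε`.
  have hmid : ∑ j ∈ Finset.Ico m (n - m + 1), l j * z (n - j) ≤ C * ε * M * Γ n := by
    calc ∑ j ∈ Finset.Ico m (n - m + 1), l j * z (n - j)
        ≤ ∑ j ∈ Finset.Ico m (n - m + 1), (C * M) * (Γ (n - j) * Γ j) := by
          refine Finset.sum_le_sum fun j hj => ?_
          have hj := Finset.mem_Ico.1 hj
          calc l j * z (n - j) ≤ (C * Γ j) * (M * Γ (n - j)) :=
                mul_le_mul (hlC j) (hzM _ (by omega)) (hz _) (mul_nonneg hC (hΓ.pos j).le)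
            _ = _ := by ring
      _ = (C * M) * ∑ j ∈ Finset.Icc m (n - m), Γ (n - j) * Γ j := by
          rw [← Finset.mul_sum]; rfl
      _ ≤ (C * M) * (ε * Γ n) := by gcongr
      _ = _ := by ring
  -- Large lags: now `l` is evaluated near `n`, where `D` applies.
  have hlast : ∑ j ∈ Finset.Ico (n - m + 1) (n + 1), l j * z (n - j)
      ≤ D * (1 + ε) * (∑ i ∈ Finset.range m, z i) * Γ n := by
    have hre := Finset.sum_Ico_reflect (fun j => l j * z (n - j)) 0 (show m ≤ n + 1 by omega)
    rw [Nat.sub_zero] at hre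
    rw [show n - m + 1 = n + 1 - m by omega, ← hre]
    calc ∑ j ∈ Finset.Ico 0 m, l (n - j) * z (n - (n - j))
        ≤ ∑ j ∈ Finset.Ico 0 m, (D * ((1 + ε) * Γ n)) * z j := by
          refine Finset.sum_le_sum fun j hj => ?_
          have hj := (Finset.mem_Ico.1 hj).2
          rw [show n - (n - j) = j by omega]
          refine mul_le_mul_of_nonneg_right ((hlD _ (by omega) (by omega)).trans ?_) (hz j)
          exact mul_le_mul_of_nonneg_left (hshift j hj) hD
      _ = _ := by rw [← Finset.mul_sum, Finset.range_eq_Ico]; ring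
  rw [h.eq_sum_range n, if_neg (by omega), zero_add, Finset.range_eq_Ico,
    ← Finset.sum_Ico_consecutive _ (Nat.zero_le m) (show m ≤ n + 1 by omega),
    ← Finset.sum_Ico_consecutive _ (show m ≤ n - m + 1 by omega)
      (show n - m + 1 ≤ n + 1 by omega)]
  linarith

lemma IsSubexp.resolvent_le {Γ l z : ℕ → ℝ} (hΓ : IsSubexp Γ) (h : IsResolvent l z)
    (hl0 : l 0 = 0) (hl : ∀ n, 0 ≤ l n) (hs : Summable l) (hA : ∑' n, l n < 1)
    {C : ℝ} (hC : 0 ≤ C) (hlC : ∀ n, l n ≤ C * Γ n) : ∃ M, 0 ≤ M ∧ ∀ n, z n ≤ M * Γ n := by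
  have hz := h.nonneg hl0 hl
  have hA0 : 0 ≤ ∑' n, l n := tsum_nonneg hl
  set A := ∑' n, l n
  obtain ⟨ε, hε, hθ⟩ : ∃ ε > 0, (1 + ε) * A + C * ε < 1 := by
    refine ⟨(1 - A) / (2 * (A + C + 1)), by have : 0 < 1 - A := by linarith
                                            positivity, ?_⟩
    have h1 : (1 - A) / (2 * (A + C + 1)) * (A + C) ≤ (1 - A) / 2 := by
      rw [div_mul_eq_mul_div, div_le_div_iff₀ (by positivity) (by norm_num)]
      nlinarith
    linarith
  obtain ⟨m, N, hstep⟩ := hΓ.resolvent_step h hl0 hl hs hC hlC hε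
  set K := C * (1 + ε) * ∑ i ∈ Finset.range m, z i
  have hK : 0 ≤ K := mul_nonneg (by positivity) (Finset.sum_nonneg fun i _ => hz i)
  set θ := (1 + ε) * A + C * ε
  have hθ' : 0 < 1 - θ := by linarith
  have hq : ∀ n, 0 ≤ z n / Γ n := fun n => div_nonneg (hz n) (hΓ.pos n).le
  -- The first summand gives `θ M + K ≤ M`, which closes the induction; the second covers `n < N`.
  refine ⟨K / (1 - θ) + ∑ n ∈ Finset.range N, z n / Γ n,
    add_nonneg (by positivity) (Finset.sum_nonneg fun n _ => hq n), fun n => ?_⟩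
  have hM0 : 0 ≤ ∑ n ∈ Finset.range N, z n / Γ n := Finset.sum_nonneg fun n _ => hq n
  set M := K / (1 - θ) + ∑ n ∈ Finset.range N, z n / Γ n with hMdef
  have hKM : K ≤ (1 - θ) * M := by
    rw [hMdef, mul_add, mul_div_cancel₀ _ hθ'.ne']
    nlinarith
  have hM : 0 ≤ M := add_nonneg (by positivity) hM0
  induction n using Nat.strong_induction_on with
  | _ n ih =>
    by_cases hn : n < N
    · rw [← div_le_iff₀ (hΓ.pos n)]
      have := Finset.single_le_sum (f := fun n => z n / Γ n) (fun n _ => hq n)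
        (Finset.mem_range.2 hn)
      have h2 : 0 ≤ K / (1 - θ) := by positivity
      linarith
    · refine ((hstep n (by omega)).2 M M C hM hM hC ih (fun k _ hk => ih k hk)
        (fun k _ _ => hlC k)).trans ?_
      refine mul_le_mul_of_nonneg_right ?_ (hΓ.pos n).le
      have : (1 + ε) * A * M + C * ε * M = θ * M := by ring
      linarith

/-- When `l = o(Γ)`, an eventual bound `c` improves to `A c + η` for every `η > 0`. Since `A < 1`,
the infimum of the eventual bounds is zero. -/
lemma IsSubexp.resolvent_isLittleO {Γ l z : ℕ → ℝ} (hΓ : IsSubexp Γ) (h : IsResolvent l z)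
    (hl0 : l 0 = 0) (hl : ∀ n, 0 ≤ l n) (hs : Summable l) (hA : ∑' n, l n < 1)
    {C : ℝ} (hC : 0 ≤ C) (hlC : ∀ n, l n ≤ C * Γ n)
    (hlo : ∀ ε > 0, ∀ᶠ n in atTop, l n ≤ ε * Γ n) :
    ∀ ε > 0, ∀ᶠ n in atTop, z n ≤ ε * Γ n := by
  have hz := h.nonneg hl0 hl
  have hA0 : 0 ≤ ∑' n, l n := tsum_nonneg hl
  obtain ⟨M, hM, hzM⟩ := hΓ.resolvent_le h hl0 hl hs hA hC hlC
  set A := ∑' n, l n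
  have hcontr : ∀ c, 0 ≤ c → (∀ᶠ n in atTop, z n ≤ c * Γ n) → ∀ η > 0,
      ∀ᶠ n in atTop, z n ≤ (A * c + η) * Γ n := by
    intro c hc hev η hη
    -- The errors are `ε A c`, `ε C M` and, by the choice of `D`, at most `ε`.
    set ε := η / (A * c + C * M + 2) with hεdef
    have hden : 0 < A * c + C * M + 2 := by positivity
    have hε : 0 < ε := by positivity
    obtain ⟨m, N, hstep⟩ := hΓ.resolvent_step h hl0 hl hs hC hlC hε
    have hS : 0 ≤ ∑ i ∈ Finset.range m, z i := Finset.sum_nonneg fun i _ => hz i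
    set S := ∑ i ∈ Finset.range m, z i
    set D := ε / ((1 + ε) * (S + 1)) with hDdef
    have hD : 0 < D := by positivity
    obtain ⟨N', hN'⟩ := eventually_atTop.1 (hev.and (hlo D hD))
    filter_upwards [eventually_ge_atTop (N + N' + m)] with n hn
    refine ((hstep n (by omega)).2 M c D hM hc hD.le (fun k _ => hzM k)
      (fun k hk _ => (hN' k (by omega)).1) (fun k hk _ => (hN' k (by omega)).2)).trans ?_
    refine mul_le_mul_of_nonneg_right ?_ (hΓ.pos n).le
    have h1 : D * (1 + ε) * S ≤ ε := by
      have : D * (1 + ε) * (S + 1) = ε := by rw [hDdef]; field_simp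
      nlinarith [mul_pos hD (show 0 < 1 + ε by positivity)]
    have h2 : ε * (A * c + C * M + 2) = η := by rw [hεdef]; field_simp
    nlinarith
  intro ε hε
  set s := {c : ℝ | 0 ≤ c ∧ ∀ᶠ n in atTop, z n ≤ c * Γ n}
  have hbdd : BddBelow s := ⟨0, fun c hc => hc.1⟩
  have hne : s.Nonempty := ⟨M, hM, Eventually.of_forall hzM⟩
  have hΛ0 : 0 ≤ sInf s := le_csInf hne fun c hc => hc.1
  have hΛ : sInf s = 0 := by
    by_contra hcon
    have hpos : 0 < sInf s := lt_of_le_of_ne hΛ0 (Ne.symm hcon)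
    -- With this `η`, `A (Λ + η) + η < Λ` for `Λ = sInf s`.
    set η := (1 - A) * sInf s / 4 with hη
    have hη0 : 0 < η := by have : 0 < 1 - A := by linarith
                           positivity
    obtain ⟨c, hc, hcl⟩ := exists_lt_of_csInf_lt hne (show sInf s < sInf s + η by linarith)
    have := csInf_le hbdd (show A * c + η ∈ s from
      ⟨add_nonneg (mul_nonneg hA0 hc.1) hη0.le, hcontr c hc.1 hc.2 η hη0⟩)
    nlinarith
  obtain ⟨c, hc, hcl⟩ := exists_lt_of_csInf_lt hne (show sInf s < ε by rw [hΛ]; exact hε)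
  filter_upwards [hc.2] with n hn
  exact hn.trans (mul_le_mul_of_nonneg_right hcl.le (hΓ.pos n).le)

/-! ### Consequences of membership in `W(r)` and `W↓(r)`; upper limits. -/

lemma InW.isSubexp {r : ℝ} {γ : ℕ → ℝ} (h : InW r γ) (hr : 0 < r) :
    IsSubexp fun n => γ n * r⁻¹ ^ n where
  pos n := mul_pos (h.pos n) (by positivity)
  ratio := by
    have := h.ratio.mul_const r
    rw [one_div, inv_mul_cancel₀ hr.ne'] at this
    refine this.congr fun n => ?_
    have := (h.pos (n + 1)).ne'
    rw [pow_succ]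
    field_simp
  conv ε hε := by
    have h1 := h.conv.eventually_lt_const (show (0 : EReal) < (ε : EReal) by exact_mod_cast hε)
    obtain ⟨m, hm, hm1⟩ := (h1.and (eventually_ge_atTop 1)).exists
    refine ⟨m, hm1, ?_⟩
    filter_upwards [eventually_lt_of_limsup_lt hm] with n hn
    rw [EReal.coe_lt_coe_iff, one_div, inv_mul_lt_iff₀ (h.pos n)] at hn
    have : ∑ i ∈ Finset.Icc m (n - m), γ (n - i) * r⁻¹ ^ (n - i) * (γ i * r⁻¹ ^ i)
        = (∑ i ∈ Finset.Icc m (n - m), γ (n - i) * γ i) * r⁻¹ ^ n := by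
      rw [Finset.sum_mul]
      refine Finset.sum_congr rfl fun i hi => ?_
      have : i ≤ n := by have := (Finset.mem_Icc.1 hi).2; omega
      have h2 : r⁻¹ ^ n = r⁻¹ ^ (n - i) * r⁻¹ ^ i := by rw [← pow_add, Nat.sub_add_cancel this]
      rw [h2]; ring
    rw [this, ← mul_assoc]
    exact mul_le_mul_of_nonneg_right (by linarith) (by positivity)

lemma InWDown.eventually_le {r : ℝ} {γ : ℕ → ℝ} (h : InWDown r γ) :
    ∀ᶠ n in atTop, ∀ k ≥ n, γ k ≤ 4 * γ n := by
  obtain ⟨-, δ, hδ, hanti, hlim⟩ := h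
  have hmono : Antitone δ := antitone_nat_of_succ_le hanti
  -- Eventually `γ k ≤ 2 δ k ≤ 2 δ n ≤ 4 γ n`.
  obtain ⟨N, hN⟩ := eventually_atTop.1 ((hlim.eventually_lt_const (show (1 : ℝ) < 2 by norm_num)).and
    (hlim.eventually_const_lt (show (1 / 2 : ℝ) < 1 by norm_num)))
  filter_upwards [eventually_ge_atTop N] with n hn k hk
  have h1 := (hN k (by omega)).1
  have h2 := (hN n hn).2
  rw [div_lt_iff₀ (hδ k)] at h1
  rw [lt_div_iff₀ (hδ n)] at h2
  linarith [hmono hk]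

/-- An upper limit is positive and finite iff the sequence is bounded and does not tend to zero. -/
lemma exists_limsup_eq_coe_iff {u : ℕ → ℝ} :
    (∃ C : ℝ, 0 < C ∧ limsup (fun n : ℕ => (u n : EReal)) atTop = (C : EReal)) ↔
      (∃ K, ∀ᶠ n in atTop, u n ≤ K) ∧ ¬ ∀ ε > 0, ∀ᶠ n in atTop, u n ≤ ε := by
  constructor
  · rintro ⟨C, hC, h⟩
    refine ⟨⟨C + 1, ?_⟩, fun hcon => ?_⟩
    · have : limsup (fun n : ℕ => (u n : EReal)) atTop < ((C + 1 : ℝ) : EReal) := by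
        rw [h]; exact_mod_cast lt_add_one C
      filter_upwards [eventually_lt_of_limsup_lt this] with n hn
      exact_mod_cast hn.le
    · have : limsup (fun n : ℕ => (u n : EReal)) atTop ≤ ((C / 2 : ℝ) : EReal) := by
        refine limsup_le_of_le (by isBoundedDefault) ?_
        filter_upwards [hcon (C / 2) (by linarith)] with n hn
        exact_mod_cast hn
      rw [h, EReal.coe_le_coe_iff] at this
      linarith
  · rintro ⟨⟨K, hK⟩, hne⟩
    push Not at hne
    obtain ⟨ε, hε, hfr⟩ := hne
    have hle : limsup (fun n : ℕ => (u n : EReal)) atTop ≤ (K : EReal) := by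
      refine limsup_le_of_le (by isBoundedDefault) ?_
      filter_upwards [hK] with n hn
      exact_mod_cast hn
    have hge : (ε : EReal) ≤ limsup (fun n : ℕ => (u n : EReal)) atTop := by
      refine le_limsup_of_frequently_le ?_ (by isBoundedDefault)
      refine hfr.mono fun n hn => ?_
      exact_mod_cast hn.le
    set L := limsup (fun n : ℕ => (u n : EReal)) atTop
    have hbot : L ≠ ⊥ := fun hb => by simp [hb] at hge
    have htop : L ≠ ⊤ := fun hb => by simp [hb] at hle
    refine ⟨L.toReal, ?_, (EReal.coe_toReal htop hbot).symm⟩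
    rw [← EReal.coe_toReal htop hbot, EReal.coe_le_coe_iff] at hge
    linarith

/-- The kernel `l b(j)`, `j ≥ 1`, extended by zero. -/
def kernel (l : ℝ) (b : ℕ → ℝ) (j : ℕ) : ℝ := if j = 0 then 0 else l * b j

lemma isResolvent_zCoeff (l : ℝ) (b : ℕ → ℝ) : IsResolvent (kernel l b) (zCoeff l b) := by
  intro n
  set φ : PowerSeries ℝ := PowerSeries.mk fun j => if j = 0 then 0 else l * b j
  -- The constant coefficient of `1 - φ` is one, so the inverse is genuine.
  have hinv : (1 - φ) * (1 - φ)⁻¹ = 1 :=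
    PowerSeries.mul_inv_cancel _ (by simp [φ])
  have heq : (1 - φ)⁻¹ = 1 + φ * (1 - φ)⁻¹ := by linear_combination hinv
  have := congrArg (PowerSeries.coeff n) heq
  rw [map_add, PowerSeries.coeff_one, PowerSeries.coeff_mul] at this
  simpa [φ, PowerSeries.coeff_mk, zCoeff, kernel] using this

/-! ### Moving averages in Banach and Hilbert spaces. -/

section Hilbert

lemma summable_smul_of_bounded {H ι : Type*} [NormedAddCommGroup H] [NormedSpace ℝ H]
    [CompleteSpace H] {l : ι → ℝ} (hs : Summable l) (hl : ∀ n, 0 ≤ l n) {u : ι → H} {M : ℝ}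
    (hM : ∀ k, ‖u k‖ ≤ M) : Summable fun j => l j • u j := by
  refine .of_norm_bounded (hs.mul_right M) fun j => ?_
  rw [norm_smul, Real.norm_of_nonneg (hl j)]
  exact mul_le_mul_of_nonneg_left (hM j) (hl j)

/-- A bounded solution of `y = l * y + ν` is the moving average `z * ν`. -/
lemma IsResolvent.hasSum_movingAverage {H : Type*} [NormedAddCommGroup H] [NormedSpace ℝ H]
    [CompleteSpace H] {l z : ℕ → ℝ} (h : IsResolvent l z) (hl0 : l 0 = 0) (hl : ∀ n, 0 ≤ l n)
    (hls : Summable l) (hzs : Summable z) {y ν : ℤ → H} {M : ℝ} (hM : ∀ k, ‖y k‖ ≤ M)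
    (hν : ∀ k, ν k = y k - ∑' j : ℕ, l j • y (k - j)) (k : ℤ) :
    HasSum (fun j : ℕ => z j • ν (k - j)) (y k) := by
  have hz := h.nonneg hl0 hl
  -- Summing `F` by rows gives `z * l * y`; by antidiagonals it gives `z * y - y`, as `z * l = z -
  -- δ₀`. Subtracting from `z * y` leaves `z * ν = y`.
  let F : ℕ × ℕ → H := fun p => (z p.1 * l p.2) • y (k - p.1 - p.2)
  have hF : Summable F :=
    summable_smul_of_bounded (hzs.mul_of_nonneg hls hz hl)
      (fun p => mul_nonneg (hz _) (hl _)) (fun p => hM (k - p.1 - p.2))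
  obtain ⟨S, hS⟩ := hF
  have h1 : HasSum (fun j : ℕ => z j • ∑' i : ℕ, l i • y (k - j - i)) S := by
    refine hS.prod_fiberwise fun j => ?_
    have := ((summable_smul_of_bounded hls hl fun i : ℕ => hM (k - j - i)).hasSum).const_smul (z j)
    simpa [F, smul_smul] using this
  have h2 : HasSum (fun n : ℕ => (z n - if n = 0 then 1 else 0) • y (k - n)) S := by
    have hσ := (Finset.HasAntidiagonal.sigmaAntidiagonalEquivProd (A := ℕ)).hasSum_iff.2 hS
    have := hσ.sigma fun n => hasSum_fintype _
    refine this.congr_fun ?_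
    intro n
    rw [h n, add_sub_cancel_left, Finset.sum_smul]
    refine Eq.trans ?_ (Finset.sum_coe_sort (Finset.HasAntidiagonal.antidiagonal n) F).symm
    rw [← Finset.Nat.sum_antidiagonal_swap]
    refine Finset.sum_congr rfl fun p hp => ?_
    rw [← Finset.HasAntidiagonal.mem_antidiagonal.1 hp, Prod.fst_swap, Prod.snd_swap]
    simp only [F]
    rw [mul_comm, Nat.cast_add, sub_sub]
  obtain ⟨T, hT⟩ := summable_smul_of_bounded hzs hz fun j : ℕ => hM (k - j)
  have h3 : HasSum (fun n : ℕ => (if n = 0 then (1 : ℝ) else 0) • y (k - n)) (y k) := by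
    have := hasSum_ite_eq (0 : ℕ) (y k)
    refine this.congr_fun ?_
    intro n
    split_ifs with hn <;> simp [hn]
  have hST : S = T - y k := by
    refine h2.unique ((hT.sub h3).congr_fun ?_)
    intro n
    rw [sub_smul]
  have h4 := hT.sub h1
  rw [hST, sub_sub_cancel] at h4
  simpa only [hν, smul_sub] using h4

open scoped InnerProductSpace in
-- Against `ν (-i)`, only the term `j = n + i` of the expansion of `y n` survives.
lemma hasSum_inner_of_movingAverage {H : Type*} [NormedAddCommGroup H] [InnerProductSpace ℝ H]
    {z : ℕ → ℝ} {y ν : ℤ → H} (hy : ∀ k : ℤ, HasSum (fun j : ℕ => z j • ν (k - j)) (y k))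
    (horth : ∀ m k : ℤ, m < k → ⟪ν k, ν m⟫_ℝ = 0) (n : ℕ) :
    HasSum (fun i : ℕ => ‖ν (-i)‖ ^ 2 * (z i * z (n + i))) ⟪y 0, y n⟫_ℝ := by
  have horth' : ∀ m k : ℤ, m ≠ k → ⟪ν m, ν k⟫_ℝ = 0 := by
    intro m k hmk
    rcases lt_or_gt_of_ne hmk with h | h
    · rw [real_inner_comm]; exact horth m k h
    · exact horth k m h
  have h1 : ∀ i : ℕ, ⟪ν (-i), y n⟫_ℝ = z (n + i) * ‖ν (-i)‖ ^ 2 := by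
    intro i
    have ha := (hy n).mapL (innerSL ℝ (ν (-i)))
    have hb := hasSum_single (f := fun j : ℕ => innerSL ℝ (ν (-i)) (z j • ν (n - j))) (n + i)
      fun j hj => by
        rw [map_smul, innerSL_apply_apply, horth' _ _ (by omega), smul_zero]
    rw [← innerSL_apply_apply ℝ, ha.unique hb, map_smul, innerSL_apply_apply,
      show (n : ℤ) - ((n + i : ℕ) : ℤ) = -i by push_cast; ring, real_inner_self_eq_norm_sq,
      smul_eq_mul]
  have h2 := (hy 0).mapL (innerSL ℝ (y n))
  rw [innerSL_apply_apply, real_inner_comm] at h2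
  refine h2.congr_fun fun i => ?_
  rw [map_smul, innerSL_apply_apply, real_inner_comm, zero_sub, h1, smul_eq_mul]
  ring

end Hilbert

/-! ### The ARCH equations in `L²`. -/

section Probability

variable {Ω : Type*} [MeasurableSpace Ω] {P : Measure Ω} {a : ℝ} {b : ℕ → ℝ} {ξ X : ℤ → Ω → ℝ}

/-- The volatility as a function of the past. -/
noncomputable def volatility (a : ℝ) (b : ℕ → ℝ) (k : ℤ) (p : Set.Iio k → ℝ) : ℝ :=
  a + ∑' j : ℕ, b (j + 1) * p ⟨k - ((j : ℤ) + 1), by simp⟩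

lemma measurable_volatility (a : ℝ) (b : ℕ → ℝ) (k : ℤ) : Measurable (volatility a b k) := by
  unfold volatility
  refine measurable_const.add (Measurable.tsum fun j => ?_)
  exact (measurable_pi_apply _).const_mul _

/-- The past of `X` strictly before time `k`. -/
def past (X : ℤ → Ω → ℝ) (k : ℤ) (ω : Ω) (m : Set.Iio k) : ℝ := X m ω

namespace IsSolution

lemma eq_ae (hX : IsSolution P a b ξ X) (k : ℤ) :
    X k =ᵐ[P] fun ω => volatility a b k (past X k ω) * ξ k ω := hX.eqn k

lemma past_measurable (hX : IsSolution P a b ξ X) (k : ℤ) : Measurable (past X k) :=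
  measurable_pi_lambda _ fun m => hX.measurable m

lemma integral_mul_past (hX : IsSolution P a b ξ X) (hξ : IsShocks P ξ) (k : ℤ)
    {f : ℝ → ℝ} (hf : Measurable f) {g : (Set.Iio k → ℝ) → ℝ} (hg : Measurable g) :
    ∫ ω, f (ξ k ω) * g (past X k ω) ∂P = (∫ ω, f (ξ k ω) ∂P) * ∫ ω, g (past X k ω) ∂P :=
  IndepFun.integral_fun_comp_mul_comp (hX.nonanticipative k) (hξ.measurable k).aemeasurable
    (hX.past_measurable k).aemeasurable hf.aestronglyMeasurable hg.aestronglyMeasurable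

end IsSolution

namespace IsWeaklyStationary

/-- The variables `X k` as elements of `L²`. -/
noncomputable def lp (h : IsWeaklyStationary P X) (k : ℤ) : Lp ℝ 2 P := (h.memLp k).toLp (X k)

lemma lp_ae (h : IsWeaklyStationary P X) (k : ℤ) : ⇑(h.lp k) =ᵐ[P] X k := MemLp.coeFn_toLp _

variable [IsProbabilityMeasure P]

/-- The constant function one in `L²`. -/
noncomputable def one (P : Measure Ω) [IsProbabilityMeasure P] : Lp ℝ 2 P :=
  (memLp_const (1 : ℝ)).toLp (fun _ : Ω => (1 : ℝ))

lemma one_ae : ⇑(one P) =ᵐ[P] fun _ => (1 : ℝ) := MemLp.coeFn_toLp _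

/-- The centred variables `X k - 𝔼 X k` as elements of `L²`. -/
noncomputable def centred (h : IsWeaklyStationary P X) (k : ℤ) : Lp ℝ 2 P :=
  h.lp k - (∫ ω, X 0 ω ∂P) • one P

open scoped InnerProductSpace

lemma inner_one_left (u : Lp ℝ 2 P) : ⟪one P, u⟫_ℝ = ∫ ω, u ω ∂P := by
  rw [L2.inner_def]
  refine integral_congr_ae ?_
  filter_upwards [one_ae (P := P)] with ω h
  simp [h]

lemma inner_one_lp (h : IsWeaklyStationary P X) (k : ℤ) :
    ⟪one P, h.lp k⟫_ℝ = ∫ ω, X 0 ω ∂P := by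
  rw [inner_one_left, integral_congr_ae (h.lp_ae k), h.mean k]

lemma inner_one_one : ⟪one P, one P⟫_ℝ = 1 := by
  rw [inner_one_left, integral_congr_ae one_ae]; simp

lemma inner_centred (h : IsWeaklyStationary P X) (m k : ℤ) :
    ⟪h.centred m, h.centred k⟫_ℝ = cov[X m, X k; P] := by
  have hc : ∀ k, ⇑(h.centred k) =ᵐ[P] fun ω => X k ω - ∫ ω, X k ω ∂P := by
    intro k
    filter_upwards [Lp.coeFn_sub (h.lp k) ((∫ ω, X 0 ω ∂P) • one P),
      Lp.coeFn_smul (∫ ω, X 0 ω ∂P) (one P), h.lp_ae k, one_ae (P := P)] with ω h1 h2 h3 h4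
    rw [centred, h1, Pi.sub_apply, h2, Pi.smul_apply, h3, h4, h.mean k]
    simp
  rw [L2.inner_def, covariance]
  refine integral_congr_ae ?_
  filter_upwards [hc m, hc k] with ω h1 h2
  rw [h1, h2]
  simp [mul_comm]

lemma exists_norm_centred_le (h : IsWeaklyStationary P X) : ∃ M, ∀ k, ‖h.centred k‖ ≤ M := by
  obtain ⟨ρ, hρ⟩ := h.cov
  refine ⟨√(ρ 0), fun k => Real.le_sqrt_of_sq_le ?_⟩
  rw [← real_inner_self_eq_norm_sq, h.inner_centred, ← hρ k 0, add_zero]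

lemma exists_norm_lp_le (h : IsWeaklyStationary P X) : ∃ M, ∀ k, ‖h.lp k‖ ≤ M := by
  obtain ⟨M, hM⟩ := h.exists_norm_centred_le
  refine ⟨M + ‖(∫ ω, X 0 ω ∂P) • one P‖, fun k => ?_⟩
  have : h.lp k = h.centred k + (∫ ω, X 0 ω ∂P) • one P := by rw [centred, sub_add_cancel]
  rw [this]
  exact (norm_add_le _ _).trans (add_le_add (hM k) le_rfl)

/-- The volatility as an element of `L²`. -/
noncomputable def vol (h : IsWeaklyStationary P X) (a : ℝ) (b : ℕ → ℝ) (k : ℤ) : Lp ℝ 2 P :=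
  a • one P + ∑' j : ℕ, b (j + 1) • h.lp (k - ((j : ℤ) + 1))

lemma summable_lp (h : IsWeaklyStationary P X) (hb : ∀ j, 1 ≤ j → 0 ≤ b j)
    (hs : Summable fun j : ℕ => b (j + 1)) (k : ℤ) :
    Summable fun j : ℕ => b (j + 1) • h.lp (k - ((j : ℤ) + 1)) :=
  summable_smul_of_bounded hs (fun j => hb _ (by omega))
    fun j => h.exists_norm_lp_le.choose_spec (k - ((j : ℤ) + 1))

/-- Summable norms make the `L²` series converge almost everywhere to the same limit, so
independence, a pointwise notion, applies to `vol`. -/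
lemma vol_ae (h : IsWeaklyStationary P X) (hb : ∀ j, 1 ≤ j → 0 ≤ b j)
    (hs : Summable fun j : ℕ => b (j + 1)) (k : ℤ) :
    ⇑(h.vol a b k) =ᵐ[P] fun ω => volatility a b k (past X k ω) := by
  have hfin : ∑' j : ℕ, ‖b (j + 1) • h.lp (k - ((j : ℤ) + 1))‖ₑ ≠ ⊤ := by
    obtain ⟨M, hM⟩ := h.exists_norm_lp_le
    have : Summable fun j : ℕ => ‖b (j + 1) • h.lp (k - ((j : ℤ) + 1))‖ := by
      refine .of_nonneg_of_le (fun _ => norm_nonneg _) (fun j => ?_) (hs.mul_right M)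
      rw [norm_smul, Real.norm_of_nonneg (hb _ (by omega))]
      exact mul_le_mul_of_nonneg_left (hM _) (hb _ (by omega))
    simp_rw [← ofReal_norm]
    exact this.tsum_ofReal_ne_top
  have hall : ∀ᵐ ω ∂P, ∀ j : ℕ, (b (j + 1) • h.lp (k - ((j : ℤ) + 1)) : Lp ℝ 2 P) ω
      = b (j + 1) * X (k - ((j : ℤ) + 1)) ω := by
    rw [ae_all_iff]
    intro j
    filter_upwards [Lp.coeFn_smul (b (j + 1)) (h.lp (k - ((j : ℤ) + 1))),
      h.lp_ae (k - ((j : ℤ) + 1))] with ω h1 h2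
    rw [h1, Pi.smul_apply, h2, smul_eq_mul]
  filter_upwards [Lp.coeFn_add (a • one P) (∑' j : ℕ, b (j + 1) • h.lp (k - ((j : ℤ) + 1))),
    Lp.coeFn_smul a (one P), one_ae (P := P), Lp.hasSum_coeFn_tsum hfin, hall]
    with ω h1 h2 h3 h4 h5
  rw [vol, h1, Pi.add_apply, h2, Pi.smul_apply, h3, ← h4.tsum_eq]
  simp only [h5, volatility, past, smul_eq_mul, mul_one]

/-- The martingale differences `X k - λ ς k`. -/
noncomputable def noise (h : IsWeaklyStationary P X) (l a : ℝ) (b : ℕ → ℝ) (k : ℤ) : Lp ℝ 2 P :=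
  h.lp k - l • h.vol a b k

lemma noise_ae (h : IsWeaklyStationary P X) (hX : IsSolution P a b ξ X)
    (hb : ∀ j, 1 ≤ j → 0 ≤ b j) (hs : Summable fun j : ℕ => b (j + 1)) (l : ℝ) (k : ℤ) :
    ⇑(h.noise l a b k) =ᵐ[P] fun ω => (ξ k ω - l) * volatility a b k (past X k ω) := by
  filter_upwards [Lp.coeFn_sub (h.lp k) (l • h.vol a b k), Lp.coeFn_smul l (h.vol a b k),
    h.lp_ae k, h.vol_ae (a := a) hb hs k, hX.eq_ae k] with ω h1 h2 h3 h4 h5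
  rw [noise, h1, Pi.sub_apply, h2, Pi.smul_apply, h3, h4, h5, smul_eq_mul]
  ring

/-- The noise is `ξ k - λ₁` times a function of the past; by independence the centred factor splits
off and integrates to zero. -/
lemma inner_noise_of_past (h : IsWeaklyStationary P X) (hX : IsSolution P a b ξ X)
    (hξ : IsShocks P ξ) (hξ1 : Integrable (ξ 0) P)
    (hb : ∀ j, 1 ≤ j → 0 ≤ b j) (hs : Summable fun j : ℕ => b (j + 1)) (k : ℤ)
    {u : Lp ℝ 2 P} {g : (Set.Iio k → ℝ) → ℝ} (hg : Measurable g)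
    (hu : ⇑u =ᵐ[P] fun ω => g (past X k ω)) :
    ⟪h.noise (∫ ω, ξ 0 ω ∂P) a b k, u⟫_ℝ = 0 := by
  have h0 : ∫ ω, (ξ k ω - ∫ ω, ξ 0 ω ∂P) ∂P = 0 := by
    rw [integral_sub ((hξ.identDistrib k).integrable_iff.2 hξ1) (integrable_const _),
      (hξ.identDistrib k).integral_eq]
    simp
  have := hX.integral_mul_past hξ k (f := fun t => t - ∫ ω, ξ 0 ω ∂P) (by fun_prop)
    ((measurable_volatility a b k).mul hg)
  rw [h0, zero_mul] at this
  rw [L2.inner_def, ← this]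
  refine integral_congr_ae ?_
  filter_upwards [h.noise_ae hX hb hs (∫ ω, ξ 0 ω ∂P) k, hu] with ω h1 h2
  rw [h1, h2]
  simp
  ring

lemma inner_noise_one (h : IsWeaklyStationary P X) (hX : IsSolution P a b ξ X)
    (hξ : IsShocks P ξ) (hξ1 : Integrable (ξ 0) P)
    (hb : ∀ j, 1 ≤ j → 0 ≤ b j) (hs : Summable fun j : ℕ => b (j + 1)) (k : ℤ) :
    ⟪h.noise (∫ ω, ξ 0 ω ∂P) a b k, one P⟫_ℝ = 0 :=
  h.inner_noise_of_past hX hξ hξ1 hb hs k (g := fun _ => 1) measurable_const one_ae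

lemma inner_noise_noise (h : IsWeaklyStationary P X) (hX : IsSolution P a b ξ X)
    (hξ : IsShocks P ξ) (hξ1 : Integrable (ξ 0) P)
    (hb : ∀ j, 1 ≤ j → 0 ≤ b j) (hs : Summable fun j : ℕ => b (j + 1)) {m k : ℤ} (hmk : m < k) :
    ⟪h.noise (∫ ω, ξ 0 ω ∂P) a b k, h.noise (∫ ω, ξ 0 ω ∂P) a b m⟫_ℝ = 0 := by
  -- The noise at time `m < k` depends only on `X m` and the past of `m`, both contained in the past
  -- of `k`.
  let res : (Set.Iio k → ℝ) → Set.Iio m → ℝ := fun p i => p ⟨i, lt_trans i.2 hmk⟩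
  have hres : Measurable res := measurable_pi_lambda _ fun i => measurable_pi_apply _
  refine h.inner_noise_of_past hX hξ hξ1 hb hs k
    (g := fun p => p ⟨m, hmk⟩ - (∫ ω, ξ 0 ω ∂P) * volatility a b m (res p)) ?_ ?_
  · exact (measurable_pi_apply _).sub (((measurable_volatility a b m).comp hres).const_mul _)
  · filter_upwards [Lp.coeFn_sub (h.lp m) ((∫ ω, ξ 0 ω ∂P) • h.vol a b m),
      Lp.coeFn_smul (∫ ω, ξ 0 ω ∂P) (h.vol a b m), h.lp_ae m, h.vol_ae (a := a) hb hs m]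
      with ω h1 h2 h3 h4
    rw [noise, h1, Pi.sub_apply, h2, Pi.smul_apply, h3, h4, smul_eq_mul]
    rfl

lemma mean_eq (h : IsWeaklyStationary P X) (hX : IsSolution P a b ξ X)
    (hξ : IsShocks P ξ) (hξ1 : Integrable (ξ 0) P)
    (hb : ∀ j, 1 ≤ j → 0 ≤ b j) (hs : Summable fun j : ℕ => b (j + 1)) :
    ∫ ω, X 0 ω ∂P
      = (∫ ω, ξ 0 ω ∂P) * (a + (∑' j : ℕ, b (j + 1)) * ∫ ω, X 0 ω ∂P) := by
  have h1 := h.inner_noise_one hX hξ hξ1 hb hs 0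
  have h2 := ((h.summable_lp hb hs 0).hasSum.mapL (innerSL ℝ (one P))).tsum_eq
  simp only [map_smul, innerSL_apply_apply, inner_one_lp, smul_eq_mul] at h2
  rw [tsum_mul_right] at h2
  rw [real_inner_comm, noise, inner_sub_right, inner_smul_right, vol, inner_add_right,
    inner_smul_right, inner_one_one, inner_one_lp, ← h2] at h1
  linarith

/-- Zero noise gives `Var ξ · 𝔼 ς² = 0`, hence `ς(0) = 0` and `X 0 = 0` almost everywhere. But a
zero mean contradicts `mean_eq`, as `λ₁ a > 0`. This provides `s 0 > 0`. -/
lemma noise_zero_ne_zero (h : IsWeaklyStationary P X) (hX : IsSolution P a b ξ X)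
    (hξ : IsShocks P ξ) (hξ1 : Integrable (ξ 0) P) (ha : 0 < a) (hmean : 0 < ∫ ω, ξ 0 ω ∂P)
    (hvar : 0 < Var[ξ 0; P])
    (hb : ∀ j, 1 ≤ j → 0 ≤ b j) (hs : Summable fun j : ℕ => b (j + 1)) :
    h.noise (∫ ω, ξ 0 ω ∂P) a b 0 ≠ 0 := by
  intro h0
  have hm := h.mean_eq hX hξ hξ1 hb hs
  have hμ : ∫ ω, X 0 ω ∂P ≠ 0 := by
    intro hz
    rw [hz, mul_zero, add_zero] at hm
    exact (mul_pos hmean ha).ne hm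
  refine hμ ?_
  have hsq := hX.integral_mul_past hξ 0 (f := fun t => (t - ∫ ω, ξ 0 ω ∂P) ^ 2) (by fun_prop)
    ((measurable_volatility a b 0).pow_const 2)
  have hz : ∫ ω, (ξ 0 ω - ∫ ω, ξ 0 ω ∂P) ^ 2 * volatility a b 0 (past X 0 ω) ^ 2 ∂P = 0 := by
    rw [← integral_zero Ω ℝ (μ := P)]
    refine integral_congr_ae ?_
    filter_upwards [h.noise_ae hX hb hs (∫ ω, ξ 0 ω ∂P) 0,
      Lp.coeFn_zero ℝ 2 P] with ω h1 h2
    rw [h0, h2] at h1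
    rw [← mul_pow, ← h1]
    simp
  rw [hz, ← variance_eq_integral (hξ.measurable 0).aemeasurable] at hsq
  have hv : ∫ ω, volatility a b 0 (past X 0 ω) ^ 2 ∂P = 0 := by
    rcases mul_eq_zero.1 hsq.symm with h1 | h1
    · exact absurd h1 hvar.ne'
    · exact h1
  have hvol : h.vol a b 0 = 0 := by
    rw [← inner_self_eq_zero (𝕜 := ℝ), L2.inner_def, ← hv]
    refine integral_congr_ae ?_
    filter_upwards [h.vol_ae (a := a) hb hs 0] with ω h1
    rw [h1]
    simp [sq]
  have hlp : h.lp 0 = 0 := by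
    rwa [noise, hvol, smul_zero, sub_zero] at h0
  rw [← h.inner_one_lp 0, hlp, inner_zero_right]

end IsWeaklyStationary

lemma kernel_nonneg {l : ℝ} (hl : 0 ≤ l) (hb : ∀ j, 1 ≤ j → 0 ≤ b j) (n : ℕ) :
    0 ≤ kernel l b n := by
  unfold kernel
  split_ifs with h
  · exact le_rfl
  · exact mul_nonneg hl (hb n (by omega))

lemma kernel_zero (l : ℝ) (b : ℕ → ℝ) : kernel l b 0 = 0 := if_pos rfl

lemma kernel_succ (l : ℝ) (b : ℕ → ℝ) (j : ℕ) : kernel l b (j + 1) = l * b (j + 1) :=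
  if_neg (by omega)

lemma summable_kernel_mul_pow {l : ℝ} {q : ℝ}
    (hs : Summable fun j : ℕ => b (j + 1) * q ^ (j + 1)) :
    Summable fun j => kernel l b j * q ^ j := by
  rw [← summable_nat_add_iff 1]
  simpa only [kernel_succ, mul_assoc] using hs.mul_left l

lemma tsum_kernel_mul_pow {l : ℝ} {q : ℝ} (hs : Summable fun j => kernel l b j * q ^ j) :
    ∑' j, kernel l b j * q ^ j = l * ∑' j : ℕ, b (j + 1) * q ^ (j + 1) := by
  rw [hs.tsum_eq_zero_add, kernel_zero, zero_mul, zero_add, ← tsum_mul_left]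
  simp only [kernel_succ, mul_assoc]

lemma CondS1.summable_kernel {l : ℝ} (h : CondS1 l b) : Summable (kernel l b) := by
  simpa using summable_kernel_mul_pow (l := l) (q := 1) (by simpa using h.1)

lemma CondS1.tsum_kernel_lt {l : ℝ} (h : CondS1 l b) : ∑' j, kernel l b j < 1 := by
  have := tsum_kernel_mul_pow (l := l) (b := b) (q := 1) (by simpa using h.summable_kernel)
  simp only [one_pow, mul_one] at this
  rw [this]; exact h.2

lemma CondS1.summable_zCoeff {l : ℝ} (hl : 0 ≤ l) (hb : ∀ j, 1 ≤ j → 0 ≤ b j)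
    (h : CondS1 l b) : Summable (zCoeff l b) :=
  (isResolvent_zCoeff l b).summable (kernel_zero l b) (kernel_nonneg hl hb)
    h.summable_kernel h.tsum_kernel_lt

variable [IsProbabilityMeasure P]

/-- Subtracting the equation for the mean removes the constant `a`. -/
lemma IsWeaklyStationary.noise_eq (h : IsWeaklyStationary P X) (hX : IsSolution P a b ξ X)
    (hξ : IsShocks P ξ) (hξ1 : Integrable (ξ 0) P)
    (hb : ∀ j, 1 ≤ j → 0 ≤ b j) (hmean : 0 < ∫ ω, ξ 0 ω ∂P)
    (hS1 : CondS1 (∫ ω, ξ 0 ω ∂P) b) (k : ℤ) :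
    h.noise (∫ ω, ξ 0 ω ∂P) a b k
      = h.centred k - ∑' j : ℕ, kernel (∫ ω, ξ 0 ω ∂P) b j • h.centred (k - j) := by
  set l := ∫ ω, ξ 0 ω ∂P with hl
  set μ := ∫ ω, X 0 ω ∂P with hμ
  obtain ⟨M, hM⟩ := h.exists_norm_centred_le
  have hsum : Summable fun j : ℕ => kernel l b j • h.centred (k - j) :=
    summable_smul_of_bounded hS1.summable_kernel (kernel_nonneg hmean.le hb) fun j => hM (k - j)
  have hm := h.mean_eq hX hξ hξ1 hb hS1.1
  rw [← hl, ← hμ] at hm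
  have hx : ∀ j : ℕ, kernel l b (j + 1) • h.centred (k - ((j + 1 : ℕ) : ℤ))
      = l • (b (j + 1) • h.lp (k - ((j : ℤ) + 1))) - (l * μ * b (j + 1)) • one P := by
    intro j
    rw [kernel_succ, centred, smul_sub, smul_smul, smul_smul, Nat.cast_succ]
    congr 2
    ring
  rw [hsum.tsum_eq_zero_add, kernel_zero, zero_smul, zero_add]
  simp_rw [hx]
  rw [Summable.tsum_sub ((h.summable_lp hb hS1.1 k).const_smul l)
    ((hS1.1.mul_left (l * μ)).smul_const _), Summable.tsum_const_smul _ (h.summable_lp hb hS1.1 k),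
    Summable.tsum_smul_const (hS1.1.mul_left (l * μ)), tsum_mul_left, noise, vol, centred,
    smul_add, smul_smul, ← hμ]
  have : (l * a) • one P = μ • one P - (l * μ * ∑' j : ℕ, b (j + 1)) • one P := by
    rw [← sub_smul]
    congr 1
    linarith
  rw [this]
  abel

/-- The autocovariance function in terms of the moving average coefficients. -/
lemma IsWeaklyStationary.exists_hasSum_autocov (h : IsWeaklyStationary P X)
    (hX : IsSolution P a b ξ X)
    (hξ : IsShocks P ξ) (hξ1 : Integrable (ξ 0) P) (ha : 0 < a)
    (hb : ∀ j, 1 ≤ j → 0 ≤ b j) (hmean : 0 < ∫ ω, ξ 0 ω ∂P) (hvar : 0 < Var[ξ 0; P])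
    (hS1 : CondS1 (∫ ω, ξ 0 ω ∂P) b) :
    ∃ s : ℕ → ℝ, 0 < s 0 ∧ (∀ i, 0 ≤ s i) ∧ (∃ S, ∀ i, s i ≤ S) ∧ ∀ n : ℕ,
      HasSum (fun i => s i * (zCoeff (∫ ω, ξ 0 ω ∂P) b i * zCoeff (∫ ω, ξ 0 ω ∂P) b (n + i)))
        (autocov P X n) := by
  obtain ⟨M, hM⟩ := h.exists_norm_centred_le
  set l := ∫ ω, ξ 0 ω ∂P
  have hk := kernel_nonneg hmean.le hb
  have hnoise := h.noise_eq hX hξ hξ1 hb hmean hS1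
  -- The bound `S` follows from `noise_eq` and the uniform bound `M` on the centred variables.
  refine ⟨fun i => ‖h.noise l a b (-i)‖ ^ 2, ?_, fun i => by positivity,
    ⟨(M + (∑' j, kernel l b j) * M) ^ 2, fun i => ?_⟩, fun n => ?_⟩
  · have := h.noise_zero_ne_zero hX hξ hξ1 ha hmean hvar hb hS1.1
    simp only [Nat.cast_zero, neg_zero]
    positivity
  · refine pow_le_pow_left₀ (norm_nonneg _) ?_ 2
    rw [hnoise]
    refine (norm_sub_le _ _).trans (add_le_add (hM _) ?_)
    refine tsum_of_norm_bounded (hS1.summable_kernel.hasSum.mul_right M) fun j => ?_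
    rw [norm_smul, Real.norm_of_nonneg (hk j)]
    exact mul_le_mul_of_nonneg_left (hM _) (hk j)
  · rw [autocov, ← h.inner_centred]
    exact hasSum_inner_of_movingAverage
      ((isResolvent_zCoeff l b).hasSum_movingAverage (kernel_zero l b) hk hS1.summable_kernel
        (hS1.summable_zCoeff hmean.le hb) hM hnoise)
      (fun m k hmk => h.inner_noise_noise hX hξ hξ1 hb hS1.1 hmk) n

end Probability

/-! ### Transfer of bounds between kernel, resolvent and autocovariance. -/

lemma exists_forall_le_mul {u γ : ℕ → ℝ} (hγ : ∀ n, 0 < γ n) {K : ℝ}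
    (h : ∀ᶠ n in atTop, u n ≤ K * γ n) : ∃ C, 0 ≤ C ∧ ∀ n, u n ≤ C * γ n := by
  obtain ⟨N, hN⟩ := eventually_atTop.1 h
  have hq : ∀ n, 0 ≤ |u n| / γ n := fun n => div_nonneg (abs_nonneg _) (hγ n).le
  have hS : 0 ≤ ∑ n ∈ Finset.range N, |u n| / γ n := Finset.sum_nonneg fun n _ => hq n
  refine ⟨|K| + ∑ n ∈ Finset.range N, |u n| / γ n, by positivity, fun n => ?_⟩
  rw [← div_le_iff₀ (hγ n)]
  by_cases hn : n < N
  · have h1 := Finset.single_le_sum (f := fun n => |u n| / γ n) (fun n _ => hq n)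
      (Finset.mem_range.2 hn)
    have h2 : u n / γ n ≤ |u n| / γ n := div_le_div_of_nonneg_right (le_abs_self _) (hγ n).le
    linarith [abs_nonneg K]
  · have h1 : u n / γ n ≤ K := (div_le_iff₀ (hγ n)).2 (hN n (by omega))
    linarith [le_abs_self K]

lemma exists_limsup_div_eq_coe_iff {u γ : ℕ → ℝ} (hγ : ∀ n, 0 < γ n) :
    (∃ C : ℝ, 0 < C ∧ limsup (fun n : ℕ => ((u n / γ n : ℝ) : EReal)) atTop = (C : EReal)) ↔
      (∃ K, ∀ᶠ n in atTop, u n ≤ K * γ n) ∧ ¬ ∀ ε > 0, ∀ᶠ n in atTop, u n ≤ ε * γ n := by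
  rw [exists_limsup_eq_coe_iff]
  simp only [div_le_iff₀ (hγ _)]

section Transfer

variable {l z γ : ℕ → ℝ} {r : ℝ}

lemma InW.resolvent_le (hγ : InW r γ) (hr : 0 < r) (h : IsResolvent l z) (hl0 : l 0 = 0)
    (hl : ∀ n, 0 ≤ l n) (hs : Summable fun n => l n * r⁻¹ ^ n)
    (hA : ∑' n, l n * r⁻¹ ^ n < 1) {K : ℝ} (hK : ∀ᶠ n in atTop, l n ≤ K * γ n) :
    ∃ M, 0 ≤ M ∧ ∀ n, z n ≤ M * γ n := by
  have hq : ∀ n, 0 < r⁻¹ ^ n := fun n => by positivity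
  obtain ⟨C, hC, hlC⟩ := exists_forall_le_mul hγ.pos hK
  obtain ⟨M, hM, hz⟩ := (hγ.isSubexp hr).resolvent_le (h.scale r⁻¹) (by simp [hl0])
    (fun n => mul_nonneg (hl n) (hq n).le) hs hA hC
    fun n => by rw [← mul_assoc]; exact mul_le_mul_of_nonneg_right (hlC n) (hq n).le
  exact ⟨M, hM, fun n => le_of_mul_le_mul_right (by rw [mul_assoc]; exact hz n) (hq n)⟩

lemma InW.resolvent_isLittleO (hγ : InW r γ) (hr : 0 < r) (h : IsResolvent l z) (hl0 : l 0 = 0)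
    (hl : ∀ n, 0 ≤ l n) (hs : Summable fun n => l n * r⁻¹ ^ n)
    (hA : ∑' n, l n * r⁻¹ ^ n < 1) (hlo : ∀ ε > 0, ∀ᶠ n in atTop, l n ≤ ε * γ n) :
    ∀ ε > 0, ∀ᶠ n in atTop, z n ≤ ε * γ n := by
  have hq : ∀ n, 0 < r⁻¹ ^ n := fun n => by positivity
  obtain ⟨C, hC, hlC⟩ := exists_forall_le_mul hγ.pos (hlo 1 one_pos)
  have hz := (hγ.isSubexp hr).resolvent_isLittleO (h.scale r⁻¹) (by simp [hl0])
    (fun n => mul_nonneg (hl n) (hq n).le) hs hA hC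
    (fun n => by rw [← mul_assoc]; exact mul_le_mul_of_nonneg_right (hlC n) (hq n).le)
    fun ε hε => (hlo ε hε).mono fun n hn => by
      rw [← mul_assoc]; exact mul_le_mul_of_nonneg_right hn (hq n).le
  exact fun ε hε => (hz ε hε).mono fun n hn =>
    le_of_mul_le_mul_right (by rw [mul_assoc]; exact hn) (hq n)

/-- Summability of `γ n * r⁻¹ ^ n` passes to `z n * r⁻¹ ^ n`, to which the unweighted statement
applies. -/
lemma InW.tsum_kernel_lt_one (hγ : InW r γ) (hr : 0 < r) (h : IsResolvent l z) (hl0 : l 0 = 0)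
    (hl : ∀ n, 0 ≤ l n) {M : ℝ} (hz : ∀ n, z n ≤ M * γ n) :
    (Summable fun n => l n * r⁻¹ ^ n) ∧ ∑' n, l n * r⁻¹ ^ n < 1 := by
  have hq : ∀ n, 0 < r⁻¹ ^ n := fun n => by positivity
  refine (h.scale r⁻¹).tsum_kernel_lt_one (by simp [hl0])
    (fun n => mul_nonneg (hl n) (hq n).le) ?_
  refine .of_nonneg_of_le (fun n => mul_nonneg (h.nonneg hl0 hl n) (hq n).le) (fun n => ?_)
    (hγ.summable.mul_left M)
  rw [← mul_assoc]
  exact mul_le_mul_of_nonneg_right (hz n) (hq n).le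

/-- Self-correlation of a summable sequence preserves asymptotic upper bounds. -/
lemma InWDown.correlation_le (hγ : InWDown r γ) {ρ s : ℕ → ℝ} (hz : ∀ n, 0 ≤ z n)
    (hzs : Summable z) (hs : ∀ i, 0 ≤ s i) {S : ℝ} (hS : ∀ i, s i ≤ S)
    (hρ : ∀ n, HasSum (fun i => s i * (z i * z (n + i))) (ρ n)) {c : ℝ} (hc : 0 ≤ c)
    (hzc : ∀ᶠ n in atTop, z n ≤ c * γ n) :
    ∀ᶠ n in atTop, ρ n ≤ 4 * S * (∑' i, z i) * c * γ n := by
  obtain ⟨N, hN⟩ := eventually_atTop.1 hzc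
  filter_upwards [hγ.eventually_le, eventually_ge_atTop N] with n hn hnN
  have hS0 : 0 ≤ S := (hs 0).trans (hS 0)
  have hsum := (hzs.hasSum.mul_left S).mul_right (c * (4 * γ n))
  refine (hasSum_le (fun i => ?_) (hρ n) hsum).trans (le_of_eq (by ring))
  rw [mul_assoc]
  refine mul_le_mul (hS i) ?_ (mul_nonneg (hz _) (hz _)) hS0
  refine mul_le_mul_of_nonneg_left ((hN _ (by omega)).trans ?_) (hz i)
  exact mul_le_mul_of_nonneg_left (hn _ (by omega)) hc

end Transfer

end ArchInf

/-! ### The equivalence. -/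

open ArchInf in
theorem theorem5p5 {Ω : Type*} [MeasurableSpace Ω] (P : Measure Ω) [IsProbabilityMeasure P]
    (a : ℝ) (b : ℕ → ℝ) (ξ X : ℤ → Ω → ℝ)
    (hξ : ArchInf.IsShocks P ξ)
    (ha : 0 < a) (hb : ∀ j, 1 ≤ j → 0 ≤ b j) (hb0 : ∃ j, 1 ≤ j ∧ b j ≠ 0)
    (hξ2 : MemLp (ξ 0) 2 P) (hmean : 0 < P[ξ 0]) (hvar : 0 < Var[ξ 0; P])
    (hX : ArchInf.IsSolution P a b ξ X) (hstat : ArchInf.IsWeaklyStationary P X)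
    (hS1 : ArchInf.CondS1 P[ξ 0] b) (hS2 : ArchInf.CondS2 P[ξ 0] √Var[ξ 0; P] b)
    (r : ℝ) (hr0 : 0 < r) (hr1 : r ≤ 1) (γ : ℕ → ℝ) (hγ : ArchInf.InWDown r γ) :
    (((Summable fun j : ℕ => b (j + 1) * r⁻¹ ^ (j + 1)) ∧
        P[ξ 0] * ∑' j : ℕ, b (j + 1) * r⁻¹ ^ (j + 1) < 1) ∧
      ∃ C : ℝ, 0 < C ∧ limsup (fun n : ℕ => ((b n / γ n : ℝ) : EReal)) atTop = (C : EReal)) ↔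
    ∃ C : ℝ, 0 < C ∧
      limsup (fun n : ℕ => ((ArchInf.autocov P X (n : ℤ) / γ n : ℝ) : EReal)) atTop
        = (C : EReal) := by
  obtain ⟨s, hs0, hs, ⟨S, hS⟩, hρ⟩ := hstat.exists_hasSum_autocov hX hξ
    (hξ2.integrable (by norm_num)) ha hb hmean hvar hS1
  have hres := isResolvent_zCoeff (P[ξ 0]) b
  have hzs := hS1.summable_zCoeff hmean.le hb
  have hl0 := kernel_zero (P[ξ 0]) b
  have hl := kernel_nonneg hmean.le hb
  set lam := P[ξ 0]
  set z := zCoeff lam b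
  have hz := hres.nonneg hl0 hl
  have hγW := hγ.1
  have hγ0 := hγW.pos
  -- Only eventually: `b 0` is arbitrary while the kernel vanishes at zero.
  have hker : ∀ᶠ n in atTop, kernel lam b n = lam * b n := by
    filter_upwards [eventually_ge_atTop 1] with n hn
    exact if_neg (by omega)
  have hzρ : ∀ n : ℕ, z n ≤ (s 0)⁻¹ * autocov P X n := by
    intro n
    have := le_hasSum (hρ n) 0 fun i _ => mul_nonneg (hs i) (mul_nonneg (hz _) (hz _))
    rw [hres.apply_zero hl0, one_mul, add_zero] at this
    rwa [inv_mul_eq_div, le_div_iff₀' hs0]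
  have hρz : ∀ c, 0 ≤ c → (∀ᶠ n in atTop, z n ≤ c * γ n) →
      ∀ᶠ n : ℕ in atTop, autocov P X n ≤ 4 * S * (∑' i, z i) * c * γ n :=
    fun c hc => hγ.correlation_le hz hzs hs hS hρ hc
  have hbz : ∀ᶠ n in atTop, b n ≤ lam⁻¹ * z n := by
    filter_upwards [hker] with n hn
    rw [inv_mul_eq_div, le_div_iff₀' hmean, ← hn]
    exact hres.kernel_le hl0 hl n
  rw [exists_limsup_div_eq_coe_iff hγ0, exists_limsup_div_eq_coe_iff hγ0]
  constructor
  · rintro ⟨⟨hsum, hlt⟩, ⟨K, hK⟩, hne⟩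
    have hks := summable_kernel_mul_pow (l := lam) hsum
    rw [← tsum_kernel_mul_pow hks] at hlt
    obtain ⟨M, hM, hzM⟩ := hγW.resolvent_le hr0 hres hl0 hl hks hlt (K := lam * K) (by
      filter_upwards [hker, hK] with n h1 h2
      rw [h1, mul_assoc]
      exact mul_le_mul_of_nonneg_left h2 hmean.le)
    -- If `ρ = o(γ)`, then `z` and hence `b` would be `o(γ)` too.
    refine ⟨⟨_, hρz M hM (.of_forall hzM)⟩, fun hcon => hne fun ε hε => ?_⟩
    filter_upwards [hbz, hcon (lam * s 0 * ε) (by positivity)] with n h1 h2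
    calc b n ≤ lam⁻¹ * ((s 0)⁻¹ * (lam * s 0 * ε * γ n)) := by
          refine h1.trans (mul_le_mul_of_nonneg_left ((hzρ n).trans ?_) (by positivity))
          exact mul_le_mul_of_nonneg_left h2 (by positivity)
      _ = ε * γ n := by field_simp
  · rintro ⟨⟨K, hK⟩, hne⟩
    obtain ⟨M, hM, hzM⟩ := exists_forall_le_mul (u := z) (K := (s 0)⁻¹ * K) hγ0 (by
      filter_upwards [hK] with n hn
      rw [mul_assoc]
      exact (hzρ n).trans (mul_le_mul_of_nonneg_left hn (by positivity)))
    obtain ⟨hks, hlt⟩ := hγW.tsum_kernel_lt_one hr0 hres hl0 hl hzM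
    have hsum : Summable fun j : ℕ => b (j + 1) * r⁻¹ ^ (j + 1) := by
      refine (((summable_nat_add_iff 1).2 hks).mul_left lam⁻¹).congr fun j => ?_
      rw [kernel_succ]
      field_simp
    refine ⟨⟨hsum, by rwa [← tsum_kernel_mul_pow hks]⟩, ⟨lam⁻¹ * M, ?_⟩, fun hcon => hne ?_⟩
    · filter_upwards [hbz] with n hn
      rw [mul_assoc]
      exact hn.trans (mul_le_mul_of_nonneg_left (hzM n) (by positivity))
    -- If `b = o(γ)`, then `z = o(γ)` and so `ρ = o(γ)`, against `hne`.
    · have hzo := hγW.resolvent_isLittleO hr0 hres hl0 hl hks hlt fun ε hε => by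
        filter_upwards [hker, hcon (ε / lam) (by positivity)] with n h1 h2
        rw [h1]
        refine (mul_le_mul_of_nonneg_left h2 hmean.le).trans (le_of_eq ?_)
        field_simp
      intro ε hε
      have hS0 : 0 < S := hs0.trans_le (hS 0)
      have hZ : 0 ≤ ∑' i, z i := tsum_nonneg hz
      set D := 4 * S * (∑' i, z i) + 1
      have hD : 0 < D := by positivity
      filter_upwards [hρz (ε / D) (by positivity) (hzo (ε / D) (by positivity))] with n hn
      refine hn.trans (mul_le_mul_of_nonneg_right ?_ (hγ0 n).le)
      calc 4 * S * (∑' i, z i) * (ε / D) ≤ D * (ε / D) := by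
            refine mul_le_mul_of_nonneg_right ?_ (by positivity)
            simp [D]
        _ = ε := by field_simp
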